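/- Let $X$ be an integral Nagata scheme, let $\nu\colon X^\nu\to X$ be its normalization (the normalization of $X$ in its function field), and let $D^b_{\mathrm{coh}}(X)$ be the full triangulated subcategory of the derived category of $\mathcal{O}_X$-modules consisting of the complexes with bounded and coherent cohomology. For objects $E,G$ of $D^b_{\mathrm{coh}}(X)$ put $\langle G\rangle_0=\operatorname{add}(0)$, $\langle G\rangle_1=\operatorname{add}(G)$ and, for $n\ge 2$, let $\langle G\rangle_n$ be $\operatorname{add}$ of the class of cones of morphisms from an object of $\langle G\rangle_{n-1}$ to an object of $\langle G\rangle_1$, where $\operatorname{add}(\mathcal{S})$ is the smallest strictly full subcategory of $D^b_{\mathrm{coh}}(X)$ that contains $\mathcal{S}$ and is closed under shifts, finite coproducts and direct summands; let $\operatorname{level}^{G}(E)$ be the least $n\ge 0$ with $E\in\langle G\rangle_n$ (and $\infty$ if there is none). Then $\mathcal{O}_X$ and $\mathbb{R}\nu_*\mathcal{O}_{X^\nu}$ belong to $D^b_{\mathrm{coh}}(X)$, and the following are equivalent: (1) $X$ is normal; (2) $\operatorname{level}^{\mathbb{R}\nu_*\mathcal{O}_{X^\nu}}(\mathcal{O}_X)\le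 1$ in $D^b_{\mathrm{coh}}(X)$. -/

import Mathlib

open CategoryTheory Limits AlgebraicGeometry

universe u v

/-! ### Levels in triangulated categories -/

section Level

variable {D : Type u} [Category.{v} D] [Preadditive D] [HasZeroObject D] [HasBinaryBiproducts D]
  [HasShift D ℤ]

/-- For a strictly full triangulated subcategory `T` of `D` (given by the property of belonging
to `T`) and a class `S` of objects, `addClosure T S` is `add(S)` formed in `T`: the smallest
strictly full subcategory of `T` that contains the objects of `T` belonging to `S` and is closed
under shifts, finite coproducts (including the empty one) and direct summands. Closure under
isomorphisms is contained in closure under direct summands. -/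
inductive addClosure (T S : ObjectProperty D) : ObjectProperty D
  | of (X : D) (hT : T X) (hS : S X) : addClosure T S X
  | zero (X : D) (hT : T X) (hX : IsZero X) : addClosure T S X
  | shift (X : D) (n : ℤ) (hT : T (X⟦n⟧)) (hX : addClosure T S X) : addClosure T S (X⟦n⟧)
  | coprod (X Y : D) (hT : T (X ⊞ Y)) (hX : addClosure T S X) (hY : addClosure T S Y) :
      addClosure T S (X ⊞ Y)
  | summand (X Y : D) (r : Retract Y X) (hT : T Y) (hX : addClosure T S X) : addClosure T S Y

variable [∀ n : ℤ, (shiftFunctor D n).Additive] [Pretriangulated D]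

/-- The objects `⟨S⟩_n` of the strictly full triangulated subcategory `T` of `D`:
`⟨S⟩_0 = add(0)`, `⟨S⟩_1 = add(S)`, and `⟨S⟩_n = add` of the class of all cones of morphisms from
an object of `⟨S⟩_{n-1}` to an object of `⟨S⟩_1`. -/
def generatedIn (T S : ObjectProperty D) : ℕ → ObjectProperty D
  | 0 => addClosure T (fun X => IsZero X)
  | 1 => addClosure T S
  | n + 2 => addClosure T (fun Z => ∃ (X Y : D) (f : X ⟶ Y) (g : Y ⟶ Z) (h : Z ⟶ X⟦(1 : ℤ)⟧),
      Pretriangulated.Triangle.mk f g h ∈ Pretriangulated.distinguishedTriangles ∧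
        generatedIn T S (n + 1) X ∧ addClosure T S Y)

/-- The level of `E` with respect to `S` in the strictly full triangulated subcategory `T` of `D`:
the least `n` such that `E` lies in `⟨S⟩_n`, and `⊤` if there is no such `n`. -/
noncomputable def level (T S : ObjectProperty D) (E : D) : ℕ∞ :=
  ⨅ (n : ℕ) (_ : generatedIn T S n E), (n : ℕ∞)

end Level

/-! ### Sheaves of modules form a Grothendieck abelian category -/

section Grothendieck

variable {C : Type u} [SmallCategory C] {J : GrothendieckTopology C} (R : Sheaf J RingCat.{u})
  [HasSheafify J AddCommGrpCat.{u}] [J.WEqualsLocallyBijective AddCommGrpCat.{u}]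

theorem presheafOfModules_hasExactColimitsOfShape (R : Cᵒᵖ ⥤ RingCat.{u})
    (K : Type u) [SmallCategory K] [IsFiltered K] :
    HasExactColimitsOfShape K (PresheafOfModules.{u} R) :=
  haveI : ReflectsFiniteLimits (PresheafOfModules.toPresheaf.{u} R) := inferInstance
  HasExactColimitsOfShape.domain_of_functor K (PresheafOfModules.toPresheaf.{u} R)

theorem sheafOfModules_isGrothendieckAbelian : IsGrothendieckAbelian.{u} (SheafOfModules.{u} R) where
  locallySmall := inferInstance
  hasFilteredColimitsOfSize := ⟨fun K _ _ => inferInstance⟩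
  ab5OfSize := by
    refine @AB5OfSize.mk _ _ _ (fun K _ _ => ?_)
    have := presheafOfModules_hasExactColimitsOfShape R.obj K
    exact (PresheafOfModules.sheafificationAdjunction (𝟙 R.obj)).hasExactColimitsOfShape K
  hasSeparator := by
    let adj := PresheafOfModules.sheafificationAdjunction (𝟙 R.obj)
    let f : C → SheafOfModules.{u} R := fun X =>
      (PresheafOfModules.sheafification (𝟙 R.obj)).obj
        ((PresheafOfModules.free R.obj).obj (yoneda.obj X))
    have hf : (ObjectProperty.ofObj f).IsSeparating := by
      intro M N a b h
      apply (SheafOfModules.forget R).map_injective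
      refine PresheafOfModules.freeYoneda.isSeparating R.obj _ _ ?_
      rintro _ ⟨X⟩ t
      obtain ⟨s, rfl⟩ := (adj.homEquiv _ M).surjective t
      have e := congrArg (adj.homEquiv _ _) (h _ ⟨X⟩ s)
      rw [adj.homEquiv_naturality_right, adj.homEquiv_naturality_right] at e
      exact e
    exact ⟨_, hf.isSeparator_coproduct⟩

end Grothendieck

/-! ### Nagata schemes -/

/-- A domain `R` is N-2 if its integral closure in every finite extension of its field of
fractions is a finite `R`-module. -/
def IsN2 (R : Type u) [CommRing R] [IsDomain R] : Prop :=
  ∀ (L : Type u) [Field L] [Algebra R L] [Algebra (FractionRing R) L]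
    [IsScalarTower R (FractionRing R) L],
    FiniteDimensional (FractionRing R) L → Module.Finite R (integralClosure R L)

/-- A ring is Nagata if it is Noetherian and all its quotients by prime ideals are N-2. -/
def IsNagataRing (R : Type u) [CommRing R] : Prop :=
  IsNoetherianRing R ∧ ∀ (p : Ideal R) [p.IsPrime], IsN2 (R ⧸ p)

namespace AlgebraicGeometry.Scheme

/-- A scheme is Nagata if every point has an affine open neighbourhood whose ring of sections
is a Nagata ring. -/
def IsNagata (X : Scheme.{u}) : Prop :=
  ∀ x : X, ∃ U : X.Opens, IsAffineOpen U ∧ x ∈ U ∧ IsNagataRing Γ(X, U)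

/-- A scheme is normal if all its local rings are integrally closed domains. -/
def IsNormal (X : Scheme.{u}) : Prop :=
  ∀ x : X, IsDomain (X.presheaf.stalk x) ∧ IsIntegrallyClosed (X.presheaf.stalk x)

/-! ### Normalization of an integral scheme -/

section Normalization

variable (X : Scheme.{u}) [IsIntegral X]

/-- The inclusion of the generic point, `Spec K(X) ⟶ X`, for `X` integral. -/
noncomputable def genericPointMap : Spec X.functionField ⟶ X :=
  X.fromSpecStalk (genericPoint X)

instance : QuasiCompact X.genericPointMap where
  isCompact_preimage _ _ _ := (Set.toFinite _).isCompact

instance : QuasiSeparated X.genericPointMap := by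
  infer_instance

/-- The normalization `X^ν` of an integral scheme `X`: the normalization of `X` in its
function field. -/
noncomputable def normalizationScheme : Scheme.{u} :=
  X.genericPointMap.normalization

/-- The normalization morphism `ν : X^ν ⟶ X`. -/
noncomputable def normalizationMap : X.normalizationScheme ⟶ X :=
  X.genericPointMap.fromNormalization

end Normalization

/-! ### The derived category of `𝒪_X`-modules and `D^b_coh(X)` -/

namespace Modules

instance (X : Scheme.{u}) : IsGrothendieckAbelian.{u} X.Modules :=
  sheafOfModules_isGrothendieckAbelian X.ringCatSheaf

/-- The derived category `D(X)` of the abelian category of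
`𝒪_X`-modules, in the standard construction by localization. -/
noncomputable instance (X : Scheme.{u}) : HasDerivedCategory.{u + 1} X.Modules :=
  HasDerivedCategory.standard _

/-- The structure sheaf `𝒪_X` as an `𝒪_X`-module. -/
noncomputable def structureSheaf (X : Scheme.{u}) : X.Modules :=
  SheafOfModules.unit X.ringCatSheaf

/-- Coherent sheaves on a locally Noetherian scheme: the quasi-coherent `𝒪_X`-modules of
finite type. -/
def IsCoherent {X : Scheme.{u}} (M : X.Modules) : Prop :=
  SheafOfModules.IsQuasicoherent M ∧ SheafOfModules.IsFiniteType M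

end Modules

/-- The class of objects of `D^b_coh(X)` inside `D(X)`, for `X` locally Noetherian: the complexes
of `𝒪_X`-modules with bounded and coherent cohomology. -/
def derivedBoundedCoherent (X : Scheme.{u}) : ObjectProperty (DerivedCategory X.Modules) :=
  fun K =>
    (∃ a b : ℤ, ∀ n : ℤ, n < a ∨ b < n →
      IsZero ((DerivedCategory.homologyFunctor X.Modules n).obj K)) ∧
    ∀ n : ℤ, Modules.IsCoherent ((DerivedCategory.homologyFunctor X.Modules n).obj K)

/-- The object `𝒪_X` of `D(X)`, placed in degree `0`. -/
noncomputable def derivedStructureSheaf (X : Scheme.{u}) : DerivedCategory X.Modules :=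
  (DerivedCategory.singleFunctor X.Modules 0).obj (Modules.structureSheaf X)

/-- The object `ℝf_* 𝒪_Y` of `D(X)` for a morphism of schemes `f : Y ⟶ X`, where `ℝf_*` is the
right derived functor of `f_*` on complexes with bounded below cohomology. -/
noncomputable def derivedPushforwardStructureSheaf {Y X : Scheme.{u}} (f : Y ⟶ X) :
    DerivedCategory X.Modules :=
  DerivedCategory.Plus.ι.obj
    ((Modules.pushforward f).rightDerivedFunctorPlus.obj
      ((DerivedCategory.Plus.singleFunctor Y.Modules 0).obj (Modules.structureSheaf Y)))

end AlgebraicGeometry.Scheme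

/-!
The normalization `ν` is an affine morphism, so `ℝν_* 𝒪` is the sheaf `ν_* 𝒪` placed in degree `0`
(`nonempty_derivedPushforwardStructureSheaf_iso`). This needs no cohomology of quasi-coherent
sheaves. Call a sheaf of modules Čech acyclic if, for every affine open `U` and all sections `f`,
`g` over `U` with `f + g` invertible, each section over `D(f) ∩ D(g)` is a difference of sections
over `D(f)` and `D(g)`. Injective sheaves are flasque, hence Čech acyclic, and `𝒪` is Čech acyclic
by a computation in the localizations. If the first term of a short exact sequence is Čech acyclic,
then a section over an affine open `U` of the third term lifts to the second one: the `f` such that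
it lifts over `D(f)` form an ideal, which locally is the unit ideal
(`surjective_app_of_cechAcyclic`). So the Čech acyclic sheaves are closed under cokernels and `ν_*`
is exact on short exact sequences of such sheaves, and a functor which is exact on a class
containing the injectives is its own right derived functor on that class (`IsAcyclicClass`).

For an affine open `U` whose ring of sections `A` is Nagata, the sections of `ν_* 𝒪` over `U` are
the integral closure of `A` in the function field, which is finite over `A`; a sheaf of modules
whose sections over basic open subsets are localizations of a finite module over a Noetherian ring
is coherent (`isCoherent_of_isLocalizing`). This gives coherence of `𝒪_X` and of `ν_* 𝒪`.

If `X` is normal, then `𝒪_X → ν_* 𝒪` is bijective over every affine open subset, so `𝒪_X` is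
isomorphic to `ℝν_* 𝒪` and has level at most `1`. Conversely, let `a / s` be an element of the
function field that is integral over the ring of sections over an affine open `U`. In `ν_* 𝒪`, every
section `a • m` over `U` is divisible by `s`. The class of sheaves with this property is closed
under direct sums and retracts, so it contains the cohomology sheaves of all objects of
`add(ℝν_* 𝒪)` (`divisible_homology_of_addClosure`). If `𝒪_X` is among these objects, then `s`
divides `a • 1`, and `a / s` is a section of `𝒪_X` over `U`.
-/

/-! ### Acyclic classes and derived functors -/

section AcyclicClass

variable {C D : Type*} [Category* C] [Abelian C] [Category* D]

/-- An acyclic complex `K` splits into the short exact sequences `0 → Zⁱ → Kⁱ → Zⁱ⁺¹ → 0`. -/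
lemma CochainComplex.shortExact_cycles {K : CochainComplex C ℤ} (hK : K.Acyclic) (i j : ℤ)
    (hij : i + 1 = j) :
    (ShortComplex.mk (K.iCycles i) (K.toCycles i j)
      (by rw [← cancel_mono (K.iCycles j)]; simp)).ShortExact := by
  have he : Epi (K.toCycles i j) := by
    obtain rfl : i = (ComplexShape.up ℤ).prev j := by simp [← hij]
    exact (hK j).epi_toCycles
  refine { exact := ?_, epi_g := he }
  refine ShortComplex.exact_of_f_is_kernel _
    (KernelFork.IsLimit.ofι' _ _ fun {A} k hk ↦
      ⟨K.liftCycles k j (by simp [← hij]) ?_, K.liftCycles_i ..⟩)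
  have hk' : k ≫ K.toCycles i j = 0 := hk
  rw [← K.toCycles_i i j, reassoc_of% hk', zero_comp]

/-- An *acyclic class* for a functor `F`: a class of objects closed under isomorphisms, finite
direct sums and cokernels of monomorphisms, such that `F` preserves the surjectivity of the
quotient map in every short exact sequence with first two terms in the class. No object of the
class is assumed to be injective. -/
structure IsAcyclicClass (F : C ⥤ D) (P : ObjectProperty C) : Prop where
  of_isZero (X : C) (hX : IsZero X) : P X
  biprod (X Y : C) (hX : P X) (hY : P Y) : P (X ⊞ Y)
  of_iso {X Y : C} (e : X ≅ Y) (hX : P X) : P Y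
  cokernel (S : ShortComplex C) (hS : S.ShortExact) (h₁ : P S.X₁) (h₂ : P S.X₂) : P S.X₃
  epi (S : ShortComplex C) (hS : S.ShortExact) (h₁ : P S.X₁) (h₂ : P S.X₂) : Epi (F.map S.g)

variable {F : C ⥤ D} {P : ObjectProperty C}

/-- The objects of cycles of a bounded below acyclic complex with terms in an acyclic class
are in the class: by induction, each one is the cokernel of the previous one. -/
lemma IsAcyclicClass.cycles (hP : IsAcyclicClass F P) {K : CochainComplex C ℤ}
    (hK : K.Acyclic) (n₀ : ℤ) [K.IsStrictlyGE n₀] (hKP : ∀ n, P (K.X n)) (n : ℤ) :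
    P (K.cycles n) := by
  by_cases hn : n₀ ≤ n
  · induction n, hn using Int.leInduction with
    | base =>
      have hz : IsZero (K.cycles (n₀ - 1)) :=
        IsZero.of_mono (K.iCycles (n₀ - 1)) (K.isZero_of_isStrictlyGE n₀ _)
      exact hP.cokernel _ (CochainComplex.shortExact_cycles hK (n₀ - 1) n₀ (by simp))
        (hP.of_isZero _ hz) (hKP _)
    | succ n _ ih =>
      exact hP.cokernel _ (CochainComplex.shortExact_cycles hK n (n + 1) rfl) ih (hKP _)
  · exact hP.of_isZero _ (IsZero.of_mono (K.iCycles n) (K.isZero_of_isStrictlyGE n₀ n))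

variable [Abelian D] [F.Additive]

lemma IsAcyclicClass.acyclic_map [PreservesFiniteLimits F] (hP : IsAcyclicClass F P)
    {K : CochainComplex C ℤ} (hK : K.Acyclic) (n₀ : ℤ) [K.IsStrictlyGE n₀]
    (hKP : ∀ n, P (K.X n)) : ((F.mapHomologicalComplex (.up ℤ)).obj K).Acyclic := by
  intro n
  rw [HomologicalComplex.exactAt_iff' _ (n - 1) n (n + 1) (by simp) (by simp),
    ShortComplex.exact_iff_exact_up_to_refinements]
  intro A (x : A ⟶ F.obj (K.X n)) (hx : x ≫ F.map (K.d n (n + 1)) = 0)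
  have he : Epi (F.map (K.toCycles (n - 1) n)) :=
    hP.epi _ (CochainComplex.shortExact_cycles hK (n - 1) n (by simp))
      (hP.cycles hK n₀ hKP _) (hKP _)
  obtain ⟨z, hz⟩ : ∃ z : A ⟶ F.obj (K.cycles n), z ≫ F.map (K.iCycles n) = x :=
    ⟨_, Fork.IsLimit.lift_ι' (KernelFork.mapIsLimit _
      (K.cyclesIsKernel n (n + 1) (by simp)) F) x (by rw [hx, comp_zero])⟩
  have key : pullback.fst z (F.map (K.toCycles (n - 1) n)) ≫ x =
      pullback.snd z (F.map (K.toCycles (n - 1) n)) ≫ F.map (K.d (n - 1) n) := by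
    rw [← hz, pullback.condition_assoc, ← F.map_comp, K.toCycles_i]
  exact ⟨_, pullback.fst z (F.map (K.toCycles (n - 1) n)), inferInstance, _, key⟩

lemma HomotopyCategory.quasiIso_iff_mappingCone_acyclic {K L : CochainComplex C ℤ} (f : K ⟶ L) :
    QuasiIso f ↔ (CochainComplex.mappingCone f).Acyclic := by
  rw [← HomotopyCategory.quotient_obj_mem_subcategoryAcyclic_iff_acyclic,
    ← HomologicalComplex.mem_quasiIso_iff, ← HomotopyCategory.quotient_map_mem_quasiIso_iff,
    HomotopyCategory.quasiIso_eq_trW_subcategoryAcyclic]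
  exact (HomotopyCategory.subcategoryAcyclic C).trW_iff_of_distinguished _
    (HomotopyCategory.mappingCone_triangleh_distinguished f)

/-- A left exact functor preserves quasi-isomorphisms between bounded below complexes with terms
in an acyclic class. -/
lemma IsAcyclicClass.quasiIso_map [PreservesFiniteLimits F] (hP : IsAcyclicClass F P)
    {K L : CochainComplex C ℤ} (f : K ⟶ L) [QuasiIso f] (n₀ : ℤ) [K.IsStrictlyGE n₀]
    [L.IsStrictlyGE n₀] (hK : ∀ n, P (K.X n)) (hL : ∀ n, P (L.X n)) :
    QuasiIso ((F.mapHomologicalComplex (.up ℤ)).map f) := by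
  have hf := (HomotopyCategory.quasiIso_iff_mappingCone_acyclic f).1 inferInstance
  have := CochainComplex.isStrictlyGE_mappingCone f n₀ n₀ (n₀ - 1)
  rw [HomotopyCategory.quasiIso_iff_mappingCone_acyclic]
  refine fun n ↦ (hP.acyclic_map hf (n₀ - 1) (fun n ↦ ?_) n).of_iso
    (CochainComplex.mappingCone.mapHomologicalComplexIso f F)
  exact hP.of_iso (HomologicalComplex.homotopyCofiber.XIsoBiprod f n (n + 1) rfl).symm
    (hP.biprod _ _ (hK _) (hL _))

variable [EnoughInjectives C] [HasDerivedCategory C] [HasDerivedCategory D]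

/-- A bounded below complex with terms in an acyclic class containing the injectives computes the
right derived functor: compare it with an injective resolution. -/
lemma IsAcyclicClass.isIso_rightDerivedFunctorPlusUnit_app [PreservesFiniteLimits F]
    (hP : IsAcyclicClass F P) (hI : ∀ (I : C) [Injective I], P I)
    (K : CochainComplex.Plus C) (hK : ∀ n, P (K.obj.X n)) :
    IsIso (F.rightDerivedFunctorPlusUnit.app ((HomotopyCategory.Plus.quotient C).obj K)) := by
  obtain ⟨n, hn⟩ := K.property
  obtain ⟨L, hL, i, hi⟩ := CochainComplex.Plus.exists_quasiIso_injective K n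
  have hi' : QuasiIso i.hom := hi
  let L' := (InjectiveObject.ι C).mapCochainComplexPlus.obj L
  have hL' : L'.obj.IsStrictlyGE n :=
    inferInstanceAs
      (CochainComplex.IsStrictlyGE
        (((InjectiveObject.ι C).mapHomologicalComplex (.up ℤ)).obj L.obj) n)
  have hLP (m : ℤ) : P (L'.obj.X m) :=
    have : Injective (L'.obj.X m) := (L.obj.X m).property
    hI _
  have hq := hP.quasiIso_map i.hom n hK hLP
  have nat := F.rightDerivedFunctorPlusUnit.naturality
    ((HomotopyCategory.Plus.quotient C).map i)
  have h1 : IsIso ((F.mapHomotopyCategoryPlus ⋙ DerivedCategory.Plus.Qh).map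
      ((HomotopyCategory.Plus.quotient C).map i)) := by
    have : IsIso (DerivedCategory.Plus.ι.map
        ((F.mapHomotopyCategoryPlus ⋙ DerivedCategory.Plus.Qh).map
          ((HomotopyCategory.Plus.quotient C).map i))) :=
      inferInstanceAs (IsIso (DerivedCategory.Q.map ((F.mapHomologicalComplex _).map i.hom)))
    exact isIso_of_fully_faithful DerivedCategory.Plus.ι _
  have h2 : IsIso ((DerivedCategory.Plus.Qh ⋙ F.rightDerivedFunctorPlus).map
      ((HomotopyCategory.Plus.quotient C).map i)) := by
    have : IsIso (DerivedCategory.Plus.Qh.map ((HomotopyCategory.Plus.quotient C).map i)) := by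
      have : IsIso (DerivedCategory.Plus.ι.map
          (DerivedCategory.Plus.Qh.map ((HomotopyCategory.Plus.quotient C).map i))) :=
        inferInstanceAs (IsIso (DerivedCategory.Q.map i.hom))
      exact isIso_of_fully_faithful DerivedCategory.Plus.ι _
    exact inferInstanceAs (IsIso (F.rightDerivedFunctorPlus.map
      (DerivedCategory.Plus.Qh.map ((HomotopyCategory.Plus.quotient C).map i))))
  have h3 : IsIso (F.rightDerivedFunctorPlusUnit.app
      ((HomotopyCategory.Plus.quotient C).obj L')) := inferInstance
  have h4 : IsIso (F.rightDerivedFunctorPlusUnit.app ((HomotopyCategory.Plus.quotient C).obj K) ≫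
      (DerivedCategory.Plus.Qh ⋙ F.rightDerivedFunctorPlus).map
        ((HomotopyCategory.Plus.quotient C).map i)) := nat ▸ inferInstance
  exact IsIso.of_isIso_comp_right _ ((DerivedCategory.Plus.Qh ⋙ F.rightDerivedFunctorPlus).map
    ((HomotopyCategory.Plus.quotient C).map i))

/-- The right derived functor of a left exact functor `F` takes an object `M` of an acyclic class
which contains the injectives to `F M` placed in the same degree. -/
theorem IsAcyclicClass.nonempty_rightDerivedFunctorPlus_single_iso [PreservesFiniteLimits F]
    (hP : IsAcyclicClass F P) (hI : ∀ (I : C) [Injective I], P I) (M : C) (hM : P M) :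
    Nonempty (DerivedCategory.Plus.ι.obj (F.rightDerivedFunctorPlus.obj
      ((DerivedCategory.Plus.singleFunctor C 0).obj M)) ≅
        (DerivedCategory.singleFunctor D 0).obj (F.obj M)) := by
  let K : CochainComplex.Plus C := ⟨(HomologicalComplex.single C (.up ℤ) 0).obj M,
    0, inferInstanceAs (((CochainComplex.singleFunctor C 0).obj M).IsStrictlyGE 0)⟩
  have := hP.isIso_rightDerivedFunctorPlusUnit_app hI K fun n ↦ by
    by_cases hn : n = 0
    · subst hn
      exact hP.of_iso (HomologicalComplex.singleObjXSelf (.up ℤ) 0 M).symm hM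
    · exact hP.of_isZero _ (HomologicalComplex.isZero_single_obj_X _ _ _ _ hn)
  exact ⟨(DerivedCategory.Plus.ι.mapIso (asIso (F.rightDerivedFunctorPlusUnit.app
    ((HomotopyCategory.Plus.quotient C).obj K)))).symm ≪≫
      DerivedCategory.Q.mapIso ((HomologicalComplex.singleMapHomologicalComplex F (.up ℤ) 0).app M)⟩

end AcyclicClass

/-! ### Sections of sheaves of modules -/

section SheafOfModules

variable {C : Type u} [SmallCategory C] {J : GrothendieckTopology C} {R : Sheaf J RingCat.{u}}
  [HasSheafify J AddCommGrpCat.{u}] [J.WEqualsLocallyBijective AddCommGrpCat.{u}]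

/-- Epimorphisms of sheaves of modules are locally surjective: the inclusion of the image in the
category of presheaves becomes an isomorphism after sheafification. -/
lemma SheafOfModules.isLocallySurjective_of_epi {M N : SheafOfModules.{u} R} (f : M ⟶ N) [Epi f] :
    Presheaf.IsLocallySurjective J ((PresheafOfModules.toPresheaf R.obj).map f.val) := by
  let S := PresheafOfModules.sheafification (𝟙 R.obj)
  let adj := PresheafOfModules.sheafificationAdjunction (𝟙 R.obj)
  let G := forget R ⋙ PresheafOfModules.restrictScalars (𝟙 R.obj)
  let p := G.map f
  have hp : Epi (S.map p) := by
    have : S.map p = adj.counit.app M ≫ f ≫ inv (adj.counit.app N) := by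
      have := adj.counit.naturality f
      dsimp at this
      rw [← reassoc_of% this]
      simp [p, G, S]
    rw [this]
    infer_instance
  have hm : Epi (S.map (image.ι p)) := by
    have : S.map p = S.map (factorThruImage p) ≫ S.map (image.ι p) := by
      rw [← S.map_comp, image.fac]
    exact epi_of_epi_fac this.symm
  have hi : IsIso (S.map (image.ι p)) := isIso_of_mono_of_epi _
  have hi' : IsIso ((presheafToSheaf J AddCommGrpCat).map
      ((PresheafOfModules.toPresheaf R.obj).map (image.ι p))) :=
    inferInstanceAs (IsIso ((SheafOfModules.toSheaf R).map (S.map (image.ι p))))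
  have hs : Presheaf.IsLocallySurjective J
      ((PresheafOfModules.toPresheaf R.obj).map (image.ι p)) := by
    rw [← GrothendieckTopology.W_iff, GrothendieckTopology.W_iff_isLocallyBijective] at hi'
    exact hi'.2
  have he : Presheaf.IsLocallySurjective J
      ((PresheafOfModules.toPresheaf R.obj).map (factorThruImage p)) :=
    Presheaf.isLocallySurjective_of_surjective _ _ fun U ↦
      PresheafOfModules.surjective_of_epi (factorThruImage p) U
  have : (PresheafOfModules.toPresheaf R.obj).map f.val =
      (PresheafOfModules.toPresheaf R.obj).map (factorThruImage p) ≫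
        (PresheafOfModules.toPresheaf R.obj).map (image.ι p) := by
    rw [← Functor.map_comp, image.fac]
    rfl
  rw [this]
  exact @Presheaf.isLocallySurjective_comp _ _ J _ _ _ _ _ _ _ _ _ _ _ he hs

lemma PresheafOfModules.freeYonedaEquiv_map_comp {R : Cᵒᵖ ⥤ RingCat.{u}}
    {M : PresheafOfModules.{u} R} {U V : C} (i : V ⟶ U)
    (φ : (free R).obj (yoneda.obj U) ⟶ M) :
    freeYonedaEquiv ((free R).map (yoneda.map i) ≫ φ) = M.map i.op (freeYonedaEquiv φ) := by
  have h := (freeAdjunction R).homEquiv_naturality_left (yoneda.map i) φ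
  simp only [freeAdjunction_homEquiv] at h
  exact (congrArg yonedaEquiv h).trans (yonedaEquiv_naturality (freeHomEquiv φ) i).symm

/-- Sections of an injective sheaf of modules extend along monomorphisms `V ⟶ U`: they are
morphisms from the sheafification of the free module on the presheaf represented by `V`, which is
a subobject of the one for `U`. -/
lemma SheafOfModules.surjective_map_of_injective (I : SheafOfModules.{u} R) [Injective I]
    {U V : C} (i : V ⟶ U) [Mono i] : Function.Surjective (I.val.map i.op) := by
  let S := PresheafOfModules.sheafification (𝟙 R.obj)
  let adj := PresheafOfModules.sheafificationAdjunction (𝟙 R.obj)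
  let j : (PresheafOfModules.free R.obj).obj (yoneda.obj V) ⟶
    (PresheafOfModules.free R.obj).obj (yoneda.obj U) :=
      (PresheafOfModules.free R.obj).map (yoneda.map i)
  have hj : Mono j := PresheafOfModules.mono_of_injective fun W ↦
    Finsupp.mapDomain_injective (fun a b h ↦ (cancel_mono i).1 h)
  intro t
  obtain ⟨φ, hφ⟩ := (PresheafOfModules.freeYonedaEquiv (M := I.val) (X := V)).surjective t
  let ψ := Injective.factorThru ((adj.homEquiv _ I).symm φ) (S.map j)
  have h : j ≫ adj.homEquiv _ I ψ = φ := by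
    rw [← adj.homEquiv_naturality_left, Injective.comp_factorThru]
    exact Equiv.apply_symm_apply _ _
  refine ⟨PresheafOfModules.freeYonedaEquiv (M := I.val) (X := U) (adj.homEquiv _ I ψ), ?_⟩
  rw [← hφ, ← h]
  exact (PresheafOfModules.freeYonedaEquiv_map_comp i _).symm

end SheafOfModules

namespace AlgebraicGeometry.Scheme.Modules

open TopologicalSpace

variable {X : Scheme.{u}}

lemma exists_app_eq_of_epi {M N : X.Modules} (φ : M ⟶ N) [Epi φ] {U : X.Opens} (s : Γ(N, U))
    {x : X} (hx : x ∈ U) :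
    ∃ (V : X.Opens) (hV : V ≤ U) (t : Γ(M, V)), x ∈ V ∧
      φ.app V t = N.presheaf.map (homOfLE hV).op s := by
  have : Presheaf.IsLocallySurjective (Opens.grothendieckTopology X)
      ((PresheafOfModules.toPresheaf X.ringCatSheaf.obj).map φ.val) :=
    @SheafOfModules.isLocallySurjective_of_epi _ _ _ X.ringCatSheaf _ _ M N φ ‹Epi φ›
  obtain ⟨V, i, ⟨t, ht⟩, hxV⟩ := Presheaf.imageSieve_mem (Opens.grothendieckTopology X)
    ((PresheafOfModules.toPresheaf X.ringCatSheaf.obj).map φ.val) (U := .op U) s x hx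
  exact ⟨V, i.le, t, hxV, ht⟩

lemma surjective_presheaf_map_of_injective (I : X.Modules) [Injective I] {U V : X.Opens}
    (h : V ≤ U) : Function.Surjective (I.presheaf.map (homOfLE h).op) :=
  @SheafOfModules.surjective_map_of_injective _ _ _ X.ringCatSheaf _ _ I ‹Injective I› _ _
    (homOfLE h) inferInstance

instance (U : X.Opens) : PreservesFiniteLimits
    (toPresheaf X ⋙ (CategoryTheory.evaluation _ _).obj (.op U)) :=
  have : PreservesLimits ((CategoryTheory.evaluation X.Opensᵒᵖ Ab.{u}).obj (.op U)) :=
    inferInstance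
  inferInstance

lemma exists_app_eq_of_shortExact {S : ShortComplex X.Modules} (hS : S.ShortExact) {U : X.Opens}
    (s : Γ(S.X₂, U)) (hs : S.g.app U s = 0) : ∃ t, S.f.app U t = s := by
  have := hS.mono_f
  exact (ShortComplex.ab_exact_iff _).1
    (hS.exact.map_of_mono_of_preservesKernel
      (toPresheaf X ⋙ (CategoryTheory.evaluation _ _).obj (.op U)) this inferInstance) s hs

lemma app_map {M N : X.Modules} (φ : M ⟶ N) {U V : X.Opens} (h : V ≤ U) (s : Γ(M, U)) :
    φ.app V (M.presheaf.map (homOfLE h).op s) = N.presheaf.map (homOfLE h).op (φ.app U s) :=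
  congr($(φ.mapPresheaf.naturality (homOfLE h).op) s)

lemma map_map (M : X.Modules) {U V W : X.Opens} (h : V ≤ U) (h' : W ≤ V) (s : Γ(M, U)) :
    M.presheaf.map (homOfLE h').op (M.presheaf.map (homOfLE h).op s) =
      M.presheaf.map (homOfLE (h'.trans h)).op s := by
  rw [← M.presheaf.map_comp_apply]
  rfl

lemma exists_glue₂ (M : X.Modules) {U V W : X.Opens} (hV : V ≤ U) (hW : W ≤ U) (hU : U ≤ V ⊔ W)
    (s : Γ(M, V)) (t : Γ(M, W))
    (h : M.presheaf.map (homOfLE (inf_le_left : V ⊓ W ≤ V)).op s =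
      M.presheaf.map (homOfLE (inf_le_right : V ⊓ W ≤ W)).op t) :
    ∃ r : Γ(M, U), M.presheaf.map (homOfLE hV).op r = s ∧ M.presheaf.map (homOfLE hW).op r = t := by
  let Z : Bool → X.Opens := fun b ↦ cond b V W
  let σ : ∀ b, Γ(M, Z b) := fun b ↦ match b with
    | true => s
    | false => t
  have hσ : TopCat.Presheaf.IsCompatible M.presheaf Z σ := by
    rintro (_ | _) (_ | _)
    · rfl
    · have h' : W ⊓ V ≤ V ⊓ W := by rw [inf_comm]
      have := congr(M.presheaf.map (homOfLE h').op $h)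
      rw [map_map, map_map] at this
      exact this.symm
    · exact h
    · rfl
  obtain ⟨r, hr, -⟩ := TopCat.Sheaf.existsUnique_gluing' ⟨_, M.isSheaf⟩ Z U
    (fun b ↦ homOfLE (by cases b <;> assumption)) (by rw [iSup_bool_eq]; exact hU) σ hσ
  exact ⟨r, hr true, hr false⟩

lemma eq_of_forall_exists_map_eq (M : X.Modules) {U : X.Opens} (s t : Γ(M, U))
    (h : ∀ x ∈ U, ∃ (V : X.Opens) (hV : V ≤ U), x ∈ V ∧
      M.presheaf.map (homOfLE hV).op s = M.presheaf.map (homOfLE hV).op t) : s = t := by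
  refine TopCat.Presheaf.IsSheaf.section_ext M.isSheaf fun x hx ↦ ?_
  obtain ⟨V, hV, hxV, e⟩ := h x hx
  exact ⟨V, hV, hxV, e⟩

lemma epi_of_surjective_app {M N : X.Modules} (φ : M ⟶ N)
    (h : ∀ U : X.Opens, IsAffineOpen U → Function.Surjective (φ.app U)) : Epi φ where
  left_cancellation {K} a b hab := by
    ext U s
    refine K.eq_of_forall_exists_map_eq _ _ fun x hx ↦ ?_
    obtain ⟨_, ⟨V, hV, rfl⟩, hxV, hVU⟩ :=
      X.isBasis_affineOpens.exists_subset_of_mem_open hx U.isOpen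
    replace hVU : V ≤ U := hVU
    refine ⟨V, hVU, hxV, ?_⟩
    obtain ⟨t, ht⟩ := h V hV (N.presheaf.map (homOfLE hVU).op s)
    have e := congr(Hom.app $hab V t)
    rw [Hom.comp_app, Hom.comp_app, ConcreteCategory.comp_apply, ConcreteCategory.comp_apply, ht,
      app_map, app_map] at e
    exact e

end AlgebraicGeometry.Scheme.Modules

/-! ### Čech acyclic sheaves -/

namespace AlgebraicGeometry.Scheme.Modules

open TopologicalSpace

variable {X : Scheme.{u}}

/-- The class of sheaves of modules `M` for which the first Čech cohomology of every covering of an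
affine open subset by two basic open subsets `D(f)` and `D(g)` with `f + g` invertible vanishes. -/
def cechAcyclic (X : Scheme.{u}) : ObjectProperty X.Modules := fun M ↦
  ∀ (U : X.Opens) (_ : IsAffineOpen U) (f g : Γ(X, U)) (_ : IsUnit (f + g))
    (s : Γ(M, X.basicOpen f ⊓ X.basicOpen g)),
    ∃ (a : Γ(M, X.basicOpen f)) (b : Γ(M, X.basicOpen g)),
      s = M.presheaf.map (homOfLE inf_le_left).op a - M.presheaf.map (homOfLE inf_le_right).op b

lemma le_basicOpen_sup_basicOpen {U : X.Opens} (f g : Γ(X, U)) (h : IsUnit (f + g)) :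
    U ≤ X.basicOpen f ⊔ X.basicOpen g := by
  have := X.basicOpen_of_isUnit h
  exact this.symm.le.trans (X.basicOpen_add_le f g)

/-- If `S` is a short exact sequence whose first term is in `cechAcyclic X`, the elements `f`
such that a given section `q` of the third term lifts over `D(f)` form an ideal. -/
def liftIdeal {S : ShortComplex X.Modules} (hS : S.ShortExact) (h₁ : cechAcyclic X S.X₁)
    {U : X.Opens} (hU : IsAffineOpen U) (q : Γ(S.X₃, U)) : Ideal Γ(X, U) where
  carrier := {f | ∃ t : Γ(S.X₂, X.basicOpen f),
    S.g.app _ t = S.X₃.presheaf.map (homOfLE (X.basicOpen_le f)).op q}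
  zero_mem' := by
    refine ⟨0, eq_of_forall_exists_map_eq _ _ _ fun x hx ↦ ?_⟩
    simp at hx
  smul_mem' := by
    rintro a f ⟨t, ht⟩
    have hle : X.basicOpen (a * f) ≤ X.basicOpen f := by
      rw [X.basicOpen_mul]; exact inf_le_right
    refine ⟨S.X₂.presheaf.map (homOfLE hle).op t, ?_⟩
    rw [app_map, ht, map_map]
  add_mem' := by
    rintro f g ⟨t, ht⟩ ⟨t', ht'⟩
    let U' := X.basicOpen (f + g)
    have hU' : U' ≤ U := X.basicOpen_le _
    let f' := X.presheaf.map (homOfLE hU').op f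
    let g' := X.presheaf.map (homOfLE hU').op g
    have hf : X.basicOpen f' ≤ X.basicOpen f := by
      rw [X.basicOpen_res]; exact inf_le_right
    have hg : X.basicOpen g' ≤ X.basicOpen g := by
      rw [X.basicOpen_res]; exact inf_le_right
    have hu : IsUnit (f' + g') := by
      rw [← map_add]
      exact RingedSpace.isUnit_res_basicOpen _ _
    have hl : X.basicOpen f' ⊓ X.basicOpen g' ≤ X.basicOpen f' := inf_le_left
    have hr : X.basicOpen f' ⊓ X.basicOpen g' ≤ X.basicOpen g' := inf_le_right
    obtain ⟨s, hs⟩ := exists_app_eq_of_shortExact hS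
      (S.X₂.presheaf.map (homOfLE (hl.trans hf)).op t -
        S.X₂.presheaf.map (homOfLE (hr.trans hg)).op t')
      (by rw [map_sub, app_map, app_map, ht, ht', map_map, map_map, sub_self])
    obtain ⟨a, b, rfl⟩ := h₁ U' (hU.basicOpen _) f' g' hu s
    have hz (U) (c : Γ(S.X₁, U)) : S.g.app U (S.f.app U c) = 0 := congr(Hom.app $S.zero U c)
    obtain ⟨r, hr₁, hr₂⟩ := exists_glue₂ S.X₂ (X.basicOpen_le f') (X.basicOpen_le g')
      (le_basicOpen_sup_basicOpen f' g' hu)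
      (S.X₂.presheaf.map (homOfLE hf).op t - S.f.app _ a)
      (S.X₂.presheaf.map (homOfLE hg).op t' - S.f.app _ b) (by
        rw [map_sub, app_map, app_map] at hs
        rw [map_sub, map_sub, map_map, map_map, sub_eq_sub_iff_sub_eq_sub]
        exact hs.symm)
    refine ⟨r, eq_of_forall_exists_map_eq _ _ _ fun x hx ↦ ?_⟩
    obtain hx' | hx' := le_basicOpen_sup_basicOpen f' g' hu hx
    · refine ⟨_, X.basicOpen_le f', hx', ?_⟩
      rw [← app_map, hr₁, map_sub, hz, app_map, ht, map_map, map_map, sub_zero]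
    · refine ⟨_, X.basicOpen_le g', hx', ?_⟩
      rw [← app_map, hr₂, map_sub, hz, app_map, ht', map_map, map_map, sub_zero]

/-- Over an affine open subset, taking sections preserves the exactness of a short exact sequence
whose first term is Čech acyclic. -/
lemma surjective_app_of_cechAcyclic {S : ShortComplex X.Modules} (hS : S.ShortExact)
    (h₁ : cechAcyclic X S.X₁) {U : X.Opens} (hU : IsAffineOpen U) :
    Function.Surjective (S.g.app U) := by
  intro q
  have := hS.epi_g
  have h : liftIdeal hS h₁ hU q = ⊤ := by
    rw [← Ideal.span_eq (liftIdeal hS h₁ hU q), ← hU.iSup_basicOpen_eq_self_iff]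
    refine le_antisymm (iSup_le fun f ↦ X.basicOpen_le _) fun x hx ↦ ?_
    obtain ⟨V, hV, t, hxV, ht⟩ := exists_app_eq_of_epi S.g q hx
    obtain ⟨f, hf, hxf⟩ := hU.exists_basicOpen_le ⟨x, hxV⟩ hx
    refine Opens.mem_iSup.2 ⟨⟨f, S.X₂.presheaf.map (homOfLE hf).op t, ?_⟩, hxf⟩
    rw [app_map, ht, map_map]
  obtain ⟨t, ht⟩ : (1 : Γ(X, U)) ∈ liftIdeal hS h₁ hU q := h ▸ Submodule.mem_top
  have h1 : U ≤ X.basicOpen (1 : Γ(X, U)) := (X.basicOpen_of_isUnit isUnit_one).symm.le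
  refine ⟨S.X₂.presheaf.map (homOfLE h1).op t, ?_⟩
  rw [app_map, ht, map_map]
  exact congr($(S.X₃.presheaf.map_id _) q)

lemma cechAcyclic_of_injective (I : X.Modules) [Injective I] : cechAcyclic X I := by
  intro U _ f g _ s
  obtain ⟨a, rfl⟩ := surjective_presheaf_map_of_injective I
    (inf_le_left : X.basicOpen f ⊓ X.basicOpen g ≤ _) s
  exact ⟨a, 0, by simp⟩

lemma cechAcyclic_cokernel {S : ShortComplex X.Modules} (hS : S.ShortExact)
    (h₁ : cechAcyclic X S.X₁) (h₂ : cechAcyclic X S.X₂) : cechAcyclic X S.X₃ := by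
  intro U hU f g hfg s
  have hV : IsAffineOpen (X.basicOpen f ⊓ X.basicOpen g) := by
    rw [← X.basicOpen_mul]; exact hU.basicOpen _
  obtain ⟨t, rfl⟩ := surjective_app_of_cechAcyclic hS h₁ hV s
  obtain ⟨a, b, rfl⟩ := h₂ U hU f g hfg t
  exact ⟨S.g.app _ a, S.g.app _ b, by rw [map_sub, app_map, app_map]⟩

lemma cechAcyclic_biprod {M N : X.Modules} (hM : cechAcyclic X M) (hN : cechAcyclic X N) :
    cechAcyclic X (M ⊞ N) := by
  intro U hU f g hfg s
  obtain ⟨a, b, h⟩ := hM U hU f g hfg ((biprod.fst : M ⊞ N ⟶ M).app _ s)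
  obtain ⟨a', b', h'⟩ := hN U hU f g hfg ((biprod.snd : M ⊞ N ⟶ N).app _ s)
  refine ⟨(biprod.inl : M ⟶ M ⊞ N).app _ a + (biprod.inr : N ⟶ M ⊞ N).app _ a',
    (biprod.inl : M ⟶ M ⊞ N).app _ b + (biprod.inr : N ⟶ M ⊞ N).app _ b', ?_⟩
  have e := congr(Hom.app $(biprod.total (X := M) (Y := N)) _ s)
  simp only [Hom.add_app, Hom.comp_app, Hom.id_app] at e
  have e' : (biprod.inl : M ⟶ M ⊞ N).app _ ((biprod.fst : M ⊞ N ⟶ M).app _ s) +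
      (biprod.inr : N ⟶ M ⊞ N).app _ ((biprod.snd : M ⊞ N ⟶ N).app _ s) = s := e
  rw [← e', h, h']
  simp only [map_add, map_sub, app_map]
  abel

lemma cechAcyclic_of_iso {M N : X.Modules} (e : M ≅ N) (hM : cechAcyclic X M) :
    cechAcyclic X N := by
  intro U hU f g hfg s
  obtain ⟨a, b, h⟩ := hM U hU f g hfg (e.inv.app _ s)
  refine ⟨e.hom.app _ a, e.hom.app _ b, ?_⟩
  have := congr(e.hom.app _ $h)
  rw [map_sub, app_map, app_map] at this
  rw [← this]
  exact congr(Hom.app $(e.inv_hom_id.symm) _ s)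

lemma cechAcyclic_of_isZero {M : X.Modules} (hM : IsZero M) : cechAcyclic X M := by
  intro U hU f g hfg s
  refine ⟨0, 0, ?_⟩
  have := congr(Hom.app $((IsZero.iff_id_eq_zero M).1 hM) _ s)
  simpa using this

lemma cechAcyclic_structureSheaf : cechAcyclic X (structureSheaf X) := by
  intro U hU f g hfg (s : Γ(X, X.basicOpen f ⊓ X.basicOpen g))
  have hle : X.basicOpen f ⊓ X.basicOpen g ≤ U := inf_le_left.trans (X.basicOpen_le f)
  let ρ : Γ(X, U) →+* Γ(X, X.basicOpen f ⊓ X.basicOpen g) := (X.presheaf.map (homOfLE hle).op).hom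
  let ρf : Γ(X, U) →+* Γ(X, X.basicOpen f) := (X.presheaf.map (homOfLE (X.basicOpen_le f)).op).hom
  let ρg : Γ(X, U) →+* Γ(X, X.basicOpen g) := (X.presheaf.map (homOfLE (X.basicOpen_le g)).op).hom
  let τf : Γ(X, X.basicOpen f) →+* Γ(X, X.basicOpen f ⊓ X.basicOpen g) :=
    (X.presheaf.map (homOfLE inf_le_left).op).hom
  let τg : Γ(X, X.basicOpen g) →+* Γ(X, X.basicOpen f ⊓ X.basicOpen g) :=
    (X.presheaf.map (homOfLE inf_le_right).op).hom
  have hf (c) : τf (ρf c) = ρ c :=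
    congr(CommRingCat.Hom.hom $((X.presheaf.map_comp _ _).symm) c)
  have hg (c) : τg (ρg c) = ρ c :=
    congr(CommRingCat.Hom.hom $((X.presheaf.map_comp _ _).symm) c)
  obtain ⟨a, n, ha⟩ : ∃ a n, s * ρ (f * g) ^ n = ρ a := by
    let := ρ.toAlgebra
    have : IsLocalization.Away (f * g) Γ(X, X.basicOpen f ⊓ X.basicOpen g) :=
      hU.isLocalization_of_eq_basicOpen (f * g) (homOfLE hle) (X.basicOpen_mul f g).symm
    obtain ⟨n, a, ha⟩ := IsLocalization.Away.surj (f * g) s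
    exact ⟨a, n, ha⟩
  obtain ⟨x, y, hxy⟩ : IsCoprime (f ^ n) (g ^ n) := by
    obtain ⟨w, hw⟩ := hfg.exists_left_inv
    exact IsCoprime.pow ⟨w, w, by rw [← mul_add, hw]⟩
  obtain ⟨f', hf'⟩ : ∃ f', ρf f * f' = 1 :=
    (RingedSpace.isUnit_res_basicOpen X.toRingedSpace f).exists_right_inv
  obtain ⟨g', hg'⟩ : ∃ g', ρg g * g' = 1 :=
    (RingedSpace.isUnit_res_basicOpen X.toRingedSpace g).exists_right_inv
  -- The section `s = a / (f g) ^ n` is split using `x f ^ n + y g ^ n = 1`.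
  refine ⟨ρf (y * a) * f' ^ n, -(ρg (x * a) * g' ^ n), ?_⟩
  have e₁ := congr(τf $hf' ^ n)
  have e₂ := congr(τg $hg' ^ n)
  have e₃ := congr(ρ $hxy)
  simp only [map_mul, map_add, map_pow, map_one, one_pow, mul_pow, hf, hg] at e₁ e₂ e₃ ha
  suffices s = τf (ρf (y * a) * f' ^ n) - τg (-(ρg (x * a) * g' ^ n)) from this
  simp only [map_mul, map_neg, map_pow, hf, hg, ← ha]
  linear_combination (-s) * e₃ - ρ y * s * ρ g ^ n * e₁ - ρ x * s * ρ f ^ n * e₂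

end AlgebraicGeometry.Scheme.Modules

/-! ### Derived pushforward along affine morphisms -/

namespace AlgebraicGeometry.Scheme.Modules

variable {X Y : Scheme.{u}}

instance (f : Y ⟶ X) : PreservesFiniteLimits (pushforward f) :=
  have := (pullbackPushforwardAdjunction f).rightAdjoint_preservesLimits
  inferInstance

/-- The preimages of affine open subsets under `f` are affine, so `f_*` is exact on Čech acyclic
sheaves. -/
lemma isAcyclicClass_cechAcyclic (f : Y ⟶ X) [IsAffineHom f] :
    IsAcyclicClass (pushforward f) (cechAcyclic Y) where
  of_isZero _ hX := cechAcyclic_of_isZero hX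
  biprod _ _ hX hY := cechAcyclic_biprod hX hY
  of_iso e hX := cechAcyclic_of_iso e hX
  cokernel _ hS h₁ h₂ := cechAcyclic_cokernel hS h₁ h₂
  epi _ hS h₁ _ := epi_of_surjective_app _ fun _ hU ↦
    surjective_app_of_cechAcyclic hS h₁ (hU.preimage f)

end AlgebraicGeometry.Scheme.Modules

namespace AlgebraicGeometry.Scheme

open Modules

variable {X Y : Scheme.{u}}

lemma nonempty_derivedPushforwardStructureSheaf_iso (f : Y ⟶ X) [IsAffineHom f] :
    Nonempty (derivedPushforwardStructureSheaf f ≅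
      (DerivedCategory.singleFunctor X.Modules 0).obj
        ((pushforward f).obj (structureSheaf Y))) :=
  (isAcyclicClass_cechAcyclic f).nonempty_rightDerivedFunctorPlus_single_iso
    (fun I _ ↦ cechAcyclic_of_injective I) _ cechAcyclic_structureSheaf

instance (X : Scheme.{u}) [IsIntegral X] : IsIntegralHom X.normalizationMap :=
  inferInstanceAs (IsIntegralHom X.genericPointMap.fromNormalization)

end AlgebraicGeometry.Scheme

/-! ### A criterion for coherence -/

namespace AlgebraicGeometry.Scheme.Modules

open TopologicalSpace

variable {X : Scheme.{u}}

/-- The sheaf associated with a finite module over a Noetherian ring has a finite presentation. -/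
lemma exists_isFinite_presentation_tilde {R : CommRingCat.{u}} [IsNoetherianRing R]
    (M : ModuleCat.{u} R) [Module.Finite R M] :
    ∃ P : (tilde M).Presentation, P.IsFinite := by
  obtain ⟨s, hs⟩ := Module.Finite.fg_top (R := R) (M := M)
  have : Finite ↥(s : Set M) := s.finite_toSet
  obtain ⟨t, ht⟩ := IsNoetherian.noetherian
    (LinearMap.ker (Finsupp.linearCombination R (Subtype.val : ↥(s : Set M) → M)))
  have : Finite ↥(t : Set (↥(s : Set M) →₀ R)) := t.finite_toSet
  refine ⟨presentationTilde M s hs t ht, ⟨⟨?_⟩, ⟨?_⟩⟩⟩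
  · exact inferInstanceAs (Finite ↥(s : Set M))
  · exact inferInstanceAs (Finite ↥(t : Set (↥(s : Set M) →₀ R)))

lemma exists_isFinite_presentation_restrict {Y : Scheme.{u}} {M : X.Modules} (f : Y ⟶ X)
    [IsOpenImmersion f] (h : ∃ P : M.Presentation, P.IsFinite) :
    ∃ P : (M.restrict f).Presentation, P.IsFinite := by
  obtain ⟨P, hP⟩ := h
  refine ⟨presentationRestrict f P, ⟨⟨?_⟩, ⟨?_⟩⟩⟩
  · exact hP.1.1
  · exact hP.2.1

lemma exists_isFinite_presentation_of_iso {M N : X.Modules} (e : M ≅ N)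
    (h : ∃ P : M.Presentation, P.IsFinite) : ∃ P : N.Presentation, P.IsFinite := by
  obtain ⟨P, hP⟩ := h
  have : @IsIso (SheafOfModules X.ringCatSheaf) _ _ _ e.hom := inferInstanceAs (IsIso e.hom)
  exact ⟨SheafOfModules.Presentation.ofIsIso.{u, u, u} e.hom P, ⟨⟨hP.1.1⟩, ⟨hP.2.1⟩⟩⟩

lemma exists_isFinite_presentation_over {M : X.Modules} (U : X.Opens)
    (h : ∃ P : (M.restrict U.ι).Presentation, P.IsFinite) :
    ∃ P : (SheafOfModules.over M U).Presentation, P.IsFinite := by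
  obtain ⟨P, hP⟩ := h
  let e : SheafOfModules (X.ringCatSheaf.over U) ≌ SheafOfModules U.toScheme.ringCatSheaf :=
    overEquiv U
  let η : SheafOfModules.unit (X.ringCatSheaf.over U) ≅
      e.inverse.obj (SheafOfModules.unit U.toScheme.ringCatSheaf) :=
    e.unitIso.app _ ≪≫ e.inverse.mapIso (Iso.refl _)
  let i : e.inverse.obj (M.restrict U.ι) ≅ SheafOfModules.over M U :=
    e.inverse.mapIso ((overFunctorEquiv U).app M).symm ≪≫ (e.unitIso.app _).symm
  have : PreservesColimitsOfSize.{u, u} e.inverse :=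
    e.symm.toAdjunction.leftAdjoint_preservesColimits
  refine ⟨SheafOfModules.Presentation.ofIsIso i.hom (P.map e.inverse η), ⟨⟨?_⟩, ⟨?_⟩⟩⟩
  · exact hP.1.1
  · exact hP.2.1

/-- A sheaf of modules which locally has a finite presentation is coherent. -/
lemma isCoherent_of_exists_presentation {M : X.Modules}
    (h : ∀ x : X, ∃ (U : X.Opens), x ∈ U ∧ ∃ P : (M.restrict U.ι).Presentation, P.IsFinite) :
    IsCoherent M := by
  choose U hU h using h
  choose P hP using fun x ↦ exists_isFinite_presentation_over (U x) (h x)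
  let σ : SheafOfModules.QuasicoherentData.{u} (R := X.ringCatSheaf) M :=
    { I := X
      X := U
      coversTop := by
        rw [Opens.coversTop_iff (T := X), IsOpenCover, eq_top_iff]
        exact fun x _ ↦ Opens.mem_iSup.2 ⟨x, hU x⟩
      presentation := P }
  have hσ' : σ.localGeneratorsData.IsFiniteType :=
    SheafOfModules.LocalGeneratorsData.IsFiniteType.mk (p := σ.localGeneratorsData)
      fun i ↦ (hP i).1
  exact ⟨SheafOfModules.IsQuasicoherent.mk (R := X.ringCatSheaf) (M := M) ⟨σ⟩,
    SheafOfModules.IsFiniteType.mk (R := X.ringCatSheaf) (M := M)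
      ⟨σ.localGeneratorsData, hσ'⟩⟩

/-- The hypotheses say that the sections over basic open subsets are localizations of the global
ones. The open subset `W` is a variable, so that they can be checked on the images of the basic open
subsets under an open immersion. -/
lemma exists_presentation_of_isLocalizing {R : CommRingCat.{u}} [IsNoetherianRing R]
    (N : (Spec R).Modules) [Module.Finite R Γ(N, ⊤)]
    (h₁ : ∀ (f : R) (W : (Spec R).Opens) (_ : W = PrimeSpectrum.basicOpen f) (s : Γ(N, W)),
      ∃ (n : ℕ) (t : Γ(N, ⊤)), f ^ n • s = N.presheaf.map (homOfLE le_top).op t)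
    (h₂ : ∀ (f : R) (W : (Spec R).Opens) (_ : W = PrimeSpectrum.basicOpen f) (t : Γ(N, ⊤)),
      N.presheaf.map (homOfLE (le_top : W ≤ ⊤)).op t = 0 → ∃ n : ℕ, f ^ n • t = 0) :
    ∃ P : N.Presentation, P.IsFinite := by
  have h : IsIso N.fromTildeΓ := by
    rw [isIso_fromTildeΓ_iff_isLocalizing]
    exact fun f ↦ IsLocalizedModule.Away.mk_of_addCommGroup
      (isUnit_algebraMap_end_of_le_basicOpen f le_rfl) (h₁ f _ rfl) (h₂ f _ rfl)
  exact exists_isFinite_presentation_of_iso (asIso N.fromTildeΓ)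
    (@exists_isFinite_presentation_tilde R ‹_› _ ‹Module.Finite R Γ(N, ⊤)›)

/-- A sheaf of modules `M` is coherent if on an affine open covering its sections over basic open
subsets are localizations of its sections, and these form a finite module over a
Noetherian ring. -/
lemma isCoherent_of_isLocalizing (M : X.Modules)
    (h : ∀ x : X, ∃ (U : X.Opens) (_ : IsAffineOpen U), x ∈ U ∧ IsNoetherianRing Γ(X, U) ∧
      Module.Finite Γ(X, U) Γ(M, U) ∧ ∀ f : Γ(X, U),
        (∀ s : Γ(M, X.basicOpen f), ∃ (n : ℕ) (t : Γ(M, U)),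
          X.presheaf.map (homOfLE (X.basicOpen_le f)).op f ^ n • s =
            M.presheaf.map (homOfLE (X.basicOpen_le f)).op t) ∧
        ∀ t : Γ(M, U), M.presheaf.map (homOfLE (X.basicOpen_le f)).op t = 0 →
          ∃ n : ℕ, f ^ n • t = 0) : IsCoherent M := by
  refine isCoherent_of_exists_presentation fun x ↦ ?_
  obtain ⟨U, hU, hx, _, hfin, H⟩ := h x
  refine ⟨U, hx, ?_⟩
  refine exists_isFinite_presentation_of_iso ((restrictFunctorComp _ _).symm.app M ≪≫
    (restrictFunctorCongr hU.isoSpec_hom_fromSpec).app M)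
    (exists_isFinite_presentation_restrict hU.isoSpec.hom (M := M.restrict hU.fromSpec) ?_)
  -- It remains to find a presentation of the restriction of `M` to `Spec Γ(X, U)`.
  set j := hU.fromSpec
  have hle (V) : j ''ᵁ V ≤ U := (j.image_le_opensRange V).trans hU.opensRange_fromSpec.le
  have htop : U ≤ j ''ᵁ ⊤ := by rw [j.image_top_eq_opensRange, hU.opensRange_fromSpec]
  let e (V : (Spec Γ(X, U)).Opens) : Γ(M.restrict j, V) ≃+ Γ(M, j ''ᵁ V) :=
    (M.restrictAppIso j V).addCommGroupIsoToAddEquiv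
  have hsmul (V : (Spec Γ(X, U)).Opens) (r : Γ(X, U)) (s : Γ(M.restrict j, V)) :
      e V (r • s) = X.presheaf.map (homOfLE (hle V)).op r • e V s := by
    refine (smul_restrictAppIso_hom_apply _ _ _ _ _).trans ?_
    have h₁ : j.appLE U V (fun x hx ↦ hle V ⟨x, hx, rfl⟩) =
        (ΓSpecIso Γ(X, U)).inv ≫ (Spec Γ(X, U)).presheaf.map V.leTop.op := by
      change j.app U ≫ (Spec Γ(X, U)).presheaf.map _ = _
      have h : j.app U = _ := hU.fromSpec_app_self
      rw [h, Category.assoc, ← Functor.map_comp]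
      rfl
    have h₂ := congr(CommRingCat.Hom.hom $(j.appLE_appIso_inv
      (fun x hx ↦ hle V ⟨x, hx, rfl⟩)) r)
    rw [h₁] at h₂
    exact congr($h₂ • e V s)
  have hmap {V W : (Spec Γ(X, U)).Opens} (h : W ≤ V) (s : Γ(M.restrict j, V)) :
      e W ((M.restrict j).presheaf.map (homOfLE h).op s) =
        M.presheaf.map (homOfLE (j.image_mono h)).op (e V s) := rfl
  let l : Γ(M, U) →ₗ[Γ(X, U)] Γ(M.restrict j, ⊤) :=
    { toFun m := (e ⊤).symm (M.presheaf.map (homOfLE (hle ⊤)).op m)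
      map_add' m m' := by rw [map_add, map_add]
      map_smul' r m := by
        rw [AddEquiv.symm_apply_eq, map_smul]
        dsimp only [RingHom.id_apply]
        rw [hsmul, AddEquiv.apply_symm_apply] }
  have hl (m) : e ⊤ (l m) = M.presheaf.map (homOfLE (hle ⊤)).op m := (e ⊤).apply_symm_apply _
  have hl' : Function.Surjective l := fun t ↦ by
    refine ⟨M.presheaf.map (homOfLE htop).op (e ⊤ t), (e ⊤).injective ?_⟩
    rw [hl, map_map]
    exact congr($(M.presheaf.map_id _) (e ⊤ t))
  have hfin' : Module.Finite Γ(X, U) Γ(M.restrict j, ⊤) := .of_surjective l hl'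
  have hD {f : Γ(X, U)} {W : (Spec Γ(X, U)).Opens} (h : W = PrimeSpectrum.basicOpen f) :
      j ''ᵁ W = X.basicOpen f := by
    rw [h]; exact hU.fromSpec_image_basicOpen f
  refine exists_presentation_of_isLocalizing (M.restrict j) ?_ ?_
  · intro f W hW s
    replace hW := hD hW
    obtain ⟨n, t, ht⟩ := (H f).1 (M.presheaf.map (homOfLE hW.ge).op (e _ s))
    refine ⟨n, l t, (e _).injective ?_⟩
    rw [hmap, hl, map_map, hsmul]
    have := congr(M.presheaf.map (homOfLE hW.le).op $ht)
    rw [map_map, ← map_pow, map_smul, map_map, ← X.presheaf.map_comp_apply] at this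
    refine Eq.trans ?_ this
    congr 1
    exact congr($(M.presheaf.map_id _) (e W s)).symm
  · intro f W hW t ht
    replace hW := hD hW
    obtain ⟨t, rfl⟩ := hl' t
    obtain ⟨n, hn⟩ := (H f).2 t (by
      have := congr(M.presheaf.map (homOfLE hW.ge).op (e _ $ht))
      rw [hmap, hl, map_map, map_map, map_zero, map_zero] at this
      exact this)
    exact ⟨n, by rw [← _root_.map_smul, hn, map_zero]⟩

end AlgebraicGeometry.Scheme.Modules

/-! ### Finiteness of the normalization -/

/-- The integral closure of a Nagata domain `A` in its field of fractions is finite: this is the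
property N-2 of `A ⧸ ⊥` for the trivial extension of the field of fractions. -/
lemma IsNagataRing.finite_integralClosure {A K : Type u} [CommRing A] [IsDomain A] [Field K]
    [Algebra A K] [IsFractionRing A K] (hA : IsNagataRing A) :
    Module.Finite A (integralClosure A K) := by
  let B := A ⧸ (⊥ : Ideal A)
  let e : A ≃+* B := (RingEquiv.quotientBot A).symm
  let : Algebra B K := ((algebraMap A K).comp e.symm.toRingHom).toAlgebra
  have : IsScalarTower A B K := .of_algebraMap_eq fun a ↦ by
    change _ = algebraMap A K (e.symm (e a))
    rw [e.symm_apply_apply]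
  have : IsFractionRing B K := by
    refine (IsFractionRing.isFractionRing_iff_of_base_ringEquiv (h := e) ..).1 ‹_›
  let : Algebra (FractionRing B) K := FractionRing.liftAlgebra B K
  have : IsScalarTower B (FractionRing B) K := FractionRing.isScalarTower_liftAlgebra B K
  have h : FiniteDimensional (FractionRing B) K := by
    refine Module.Finite.of_surjective (Algebra.linearMap (FractionRing B) K) fun x ↦ ?_
    obtain ⟨a, b, hb, rfl⟩ := IsFractionRing.div_surjective (A := B) x
    refine ⟨algebraMap _ _ a / algebraMap _ _ b, ?_⟩
    rw [Algebra.linearMap_apply, map_div₀, ← IsScalarTower.algebraMap_apply,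
      ← IsScalarTower.algebraMap_apply]
  have hfin : Module.Finite B (integralClosure B K) := hA.2 ⊥ K h
  have : Module.Finite A (integralClosure B K) := .trans B _
  let l : integralClosure B K →ₗ[A] integralClosure A K :=
    { toFun x := ⟨x, isIntegral_trans (x : K) x.2⟩
      map_add' _ _ := rfl
      map_smul' _ _ := rfl }
  exact .of_surjective l fun x ↦ ⟨⟨x, x.2.tower_top⟩, rfl⟩

lemma SheafOfModules.IsFiniteType.of_iso {C : Type u} [Category.{v} C] {J : GrothendieckTopology C}
    {R : Sheaf J RingCat.{u}} [HasSheafify J AddCommGrpCat.{u}]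
    [J.WEqualsLocallyBijective AddCommGrpCat.{u}]
    [∀ X, HasSheafify (J.over X) AddCommGrpCat.{u}]
    [∀ X, (J.over X).WEqualsLocallyBijective AddCommGrpCat.{u}]
    {M N : SheafOfModules.{u} R} (e : M ≅ N) (h : M.IsFiniteType) : N.IsFiniteType := by
  obtain ⟨τ, hτ⟩ := h
  have (U : C) : IsIso (e.hom.over U) :=
    inferInstanceAs (IsIso ((SheafOfModules.overFunctor _ U).map e.hom))
  exact ⟨⟨τ.I, τ.X, τ.coversTop, fun i ↦ (τ.generators i).ofEpi (e.hom.over (τ.X i))⟩,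
    ⟨fun i ↦ ⟨(hτ.1 i).1⟩⟩⟩

namespace AlgebraicGeometry.Scheme

variable (X : Scheme.{u}) [IsIntegral X]

/-- Sections of the normalization of `X` over the preimage of an affine open subset `U` are the
integral closure of `Γ(X, U)` in the function field. -/
lemma exists_integralClosure_ringEquiv {U : X.Opens} (hU : IsAffineOpen U) [Nonempty U] :
    ∃ φ : integralClosure Γ(X, U) X.functionField ≃+*
      Γ(X.normalizationScheme, X.normalizationMap ⁻¹ᵁ U),
      ∀ a, φ (algebraMap _ _ a) = X.normalizationMap.app U a := by
  let g := X.genericPointMap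
  have hη : genericPoint X ∈ U :=
    ((genericPoint_spec X).mem_open_set_iff U.isOpen).mpr (by simpa using ‹Nonempty U›)
  have htop : g ⁻¹ᵁ U = ⊤ := by
    refine eq_top_iff.2 fun y _ ↦ ?_
    have hy : g y ∈ Set.range g := ⟨y, rfl⟩
    rw [show Set.range g = _ from X.range_fromSpecStalk] at hy
    exact (show g y ⤳ genericPoint X from hy).mem_open U.2 hη
  let := (g.app U).hom.toAlgebra
  let r := (Spec X.functionField).presheaf.map (homOfLE (le_top : g ⁻¹ᵁ U ≤ ⊤)).op
  have hr : IsIso r := by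
    have : IsIso (homOfLE (le_top : g ⁻¹ᵁ U ≤ ⊤)) :=
      inferInstanceAs (IsIso (eqToHom htop))
    infer_instance
  let e : X.functionField ≅ Γ(Spec X.functionField, g ⁻¹ᵁ U) :=
    (ΓSpecIso X.functionField).symm ≪≫ asIso r
  let ε : X.functionField ≃ₐ[Γ(X, U)] Γ(Spec X.functionField, g ⁻¹ᵁ U) :=
    AlgEquiv.ofRingEquiv (f := e.commRingCatIsoToRingEquiv) fun a ↦
      congr(CommRingCat.Hom.hom $((fromSpecStalk_app hη).symm) a)
  refine ⟨ε.mapIntegralClosure.toRingEquiv.trans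
    (g.normalizationObjIso hU).symm.commRingCatIsoToRingEquiv, fun a ↦ ?_⟩
  refine Eq.trans ?_ congr(CommRingCat.Hom.hom $((g.fromNormalization_app hU).symm) a)
  exact congr((g.normalizationObjIso hU).inv $(ε.mapIntegralClosure.commutes a))

variable {X}

lemma finite_normalizationMap_app {U : X.Opens} (hU : IsAffineOpen U) [Nonempty U]
    (h : IsNagataRing Γ(X, U)) : (X.normalizationMap.app U).hom.Finite := by
  have := functionField_isFractionRing_of_isAffineOpen X U hU
  have := h.finite_integralClosure (K := X.functionField)
  obtain ⟨φ, hφ⟩ := X.exists_integralClosure_ringEquiv hU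
  have : (algebraMap Γ(X, U) (integralClosure Γ(X, U) X.functionField)).Finite :=
    RingHom.finite_algebraMap.2 this
  convert! (RingHom.Finite.of_surjective φ.toRingHom φ.surjective).comp this
  ext a
  exact (hφ a).symm

namespace Modules

variable {X Y : Scheme.{u}}

/-- The sheaf `f_* 𝒪_Y` is coherent if `f : Y ⟶ X` is affine and locally on `X` it is given by
finite ring maps from Noetherian rings. -/
lemma isCoherent_pushforward_structureSheaf (f : Y ⟶ X) [IsAffineHom f]
    (h : ∀ x : X, ∃ (U : X.Opens) (_ : IsAffineOpen U), x ∈ U ∧ IsNoetherianRing Γ(X, U) ∧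
      (f.app U).hom.Finite) : IsCoherent ((pushforward f).obj (structureSheaf Y)) := by
  refine isCoherent_of_isLocalizing _ fun x ↦ ?_
  obtain ⟨U, hU, hx, hN, hfin⟩ := h x
  refine ⟨U, hU, hx, hN, hfin, fun r ↦ ?_⟩
  have hle : f ⁻¹ᵁ X.basicOpen r ≤ f ⁻¹ᵁ U := f.preimage_mono (X.basicOpen_le r)
  let ρ := Y.presheaf.map (homOfLE hle).op
  let := ρ.hom.toAlgebra
  have : IsLocalization.Away (f.app U r) Γ(Y, f ⁻¹ᵁ X.basicOpen r) :=
    (hU.preimage f).isLocalization_of_eq_basicOpen _ (homOfLE hle) (f.preimage_basicOpen r)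
  have hρ : ρ (f.app U r) = f.app _ (X.presheaf.map (homOfLE (X.basicOpen_le r)).op r) :=
    congr(CommRingCat.Hom.hom $((f.naturality (homOfLE (X.basicOpen_le r)).op).symm) r)
  constructor
  · intro (s : Γ(Y, f ⁻¹ᵁ X.basicOpen r))
    obtain ⟨n, t, ht⟩ := IsLocalization.Away.surj (f.app U r) s
    refine ⟨n, t, Eq.trans ?_ ht⟩
    change f.app _ (_ ^ n) * s = s * (ρ (f.app U r)) ^ n
    rw [hρ, map_pow, mul_comm]
    rfl
  · intro (t : Γ(Y, f ⁻¹ᵁ U)) (ht : ρ t = 0)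
    obtain ⟨⟨_, n, rfl⟩, hn⟩ := (IsLocalization.map_eq_zero_iff (.powers (f.app U r)) _ t).1 ht
    refine ⟨n, Eq.trans ?_ hn⟩
    change f.app U (r ^ n) * t = f.app U r ^ n * t
    rw [map_pow]

lemma isCoherent_of_isZero {M : X.Modules} (hM : IsZero M)
    (h : ∀ x : X, ∃ (U : X.Opens) (_ : IsAffineOpen U), x ∈ U ∧ IsNoetherianRing Γ(X, U)) :
    IsCoherent M := by
  refine isCoherent_of_isLocalizing _ fun x ↦ ?_
  obtain ⟨U, hU, hx, hN⟩ := h x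
  have hz (V : X.Opens) (s : Γ(M, V)) : s = 0 :=
    congr(Hom.app $((IsZero.iff_id_eq_zero M).1 hM) _ s)
  have (V : X.Opens) : Subsingleton Γ(M, V) := ⟨fun s t ↦ by rw [hz V s, hz V t]⟩
  exact ⟨U, hU, hx, hN, inferInstance, fun r ↦
    ⟨fun s ↦ ⟨0, 0, Subsingleton.elim _ _⟩, fun t _ ↦ ⟨0, Subsingleton.elim _ _⟩⟩⟩

lemma IsCoherent.of_iso {M N : X.Modules} (e : M ≅ N) (h : IsCoherent M) : IsCoherent N := by
  have he := @SheafOfModules.IsFiniteType.of_iso _ _ _ X.ringCatSheaf _ _ _ _ M N e h.2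
  exact ⟨(SheafOfModules.isQuasicoherent X.ringCatSheaf).prop_of_iso e h.1, he⟩

end Modules

end AlgebraicGeometry.Scheme

/-! ### Coherence of the cohomology sheaves -/

namespace AlgebraicGeometry.Scheme

open Modules

variable {X : Scheme.{u}}

lemma IsNagata.exists_affine_isNoetherianRing (hX : X.IsNagata) (x : X) :
    ∃ (U : X.Opens) (_ : IsAffineOpen U), x ∈ U ∧ IsNoetherianRing Γ(X, U) := by
  obtain ⟨U, hU, hx, h⟩ := hX x
  exact ⟨U, hU, hx, h.1⟩

lemma isCoherent_structureSheaf (hX : X.IsNagata) : IsCoherent (structureSheaf X) := by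
  refine IsCoherent.of_iso ((pushforwardId X).app _)
    (isCoherent_pushforward_structureSheaf (𝟙 X) fun x ↦ ?_)
  obtain ⟨U, hU, hx, h⟩ := hX x
  exact ⟨U, hU, hx, h.1, RingHom.Finite.id _⟩

lemma isCoherent_pushforward_normalizationMap [IsIntegral X] (hX : X.IsNagata) :
    IsCoherent ((pushforward X.normalizationMap).obj (structureSheaf X.normalizationScheme)) := by
  refine isCoherent_pushforward_structureSheaf _ fun x ↦ ?_
  obtain ⟨U, hU, hx, h⟩ := hX x
  have : Nonempty U := ⟨x, hx⟩
  exact ⟨U, hU, hx, h.1, finite_normalizationMap_app hU h⟩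

lemma derivedBoundedCoherent_of_iso {E F : DerivedCategory X.Modules} (e : E ≅ F)
    (h : X.derivedBoundedCoherent E) : X.derivedBoundedCoherent F := by
  obtain ⟨⟨a, b, hab⟩, hcoh⟩ := h
  have e' (n : ℤ) := (DerivedCategory.homologyFunctor X.Modules n).mapIso e
  exact ⟨⟨a, b, fun n hn ↦ (hab n hn).of_iso (e' n).symm⟩, fun n ↦ (hcoh n).of_iso (e' n)⟩

lemma isZero_homologyFunctor_singleFunctor_obj (M : X.Modules) {n : ℤ} (hn : n ≠ 0) :
    IsZero ((DerivedCategory.homologyFunctor X.Modules n).obj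
      ((DerivedCategory.singleFunctor X.Modules 0).obj M)) := by
  obtain hn | hn := hn.lt_or_gt
  · exact DerivedCategory.isZero_of_isGE _ 0 n hn
  · exact DerivedCategory.isZero_of_isLE _ 0 n hn

lemma derivedBoundedCoherent_singleFunctor_obj
    (hX : X.IsNagata) {M : X.Modules} (hM : IsCoherent M) :
    X.derivedBoundedCoherent ((DerivedCategory.singleFunctor X.Modules 0).obj M) := by
  refine ⟨⟨0, 0, fun n hn ↦ isZero_homologyFunctor_singleFunctor_obj M (by grind)⟩, fun n ↦ ?_⟩
  obtain rfl | hn := eq_or_ne n 0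
  · exact hM.of_iso ((DerivedCategory.singleFunctorCompHomologyFunctorIso X.Modules 0).app M).symm
  · exact isCoherent_of_isZero (isZero_homologyFunctor_singleFunctor_obj M hn)
      hX.exists_affine_isNoetherianRing

lemma derivedBoundedCoherent_derivedStructureSheaf (hX : X.IsNagata) :
    X.derivedBoundedCoherent X.derivedStructureSheaf :=
  derivedBoundedCoherent_singleFunctor_obj hX (isCoherent_structureSheaf hX)

lemma derivedBoundedCoherent_derivedPushforwardStructureSheaf [IsIntegral X] (hX : X.IsNagata) :
    X.derivedBoundedCoherent (derivedPushforwardStructureSheaf X.normalizationMap) := by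
  obtain ⟨e⟩ := nonempty_derivedPushforwardStructureSheaf_iso X.normalizationMap
  exact derivedBoundedCoherent_of_iso e.symm
    (derivedBoundedCoherent_singleFunctor_obj hX (isCoherent_pushforward_normalizationMap hX))

/-! ### Sections divisible along a fraction -/

/-- The class of sheaves of modules `M` such that over `U` every section `a • m` is divisible
by `s`. -/
def divisible (U : X.Opens) (a s : Γ(X, U)) : ObjectProperty X.Modules := fun M ↦
  ∀ m : Γ(M, U), ∃ m' : Γ(M, U), s • m' = a • m

variable {U : X.Opens} {a s : Γ(X, U)}

lemma divisible_of_retract {M N : X.Modules} (r : Retract N M) (hM : divisible U a s M) :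
    divisible U a s N := by
  intro m
  obtain ⟨m', h⟩ := hM (r.i.app U m)
  refine ⟨r.r.app U m', ?_⟩
  rw [← Hom.app_smul, h, Hom.app_smul]
  exact congr(a • Modules.Hom.app $(r.retract) U m)

lemma divisible_of_isZero {M : X.Modules} (hM : IsZero M) : divisible U a s M := by
  have hz (s : Γ(M, U)) : s = 0 := congr(Modules.Hom.app $((IsZero.iff_id_eq_zero M).1 hM) _ s)
  exact fun m ↦ ⟨0, by rw [hz (s • 0), hz (a • m)]⟩

lemma divisible_biprod {M N : X.Modules} (hM : divisible U a s M) (hN : divisible U a s N) :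
    divisible U a s (M ⊞ N) := by
  intro m
  obtain ⟨x, hx⟩ := hM ((biprod.fst : M ⊞ N ⟶ M).app U m)
  obtain ⟨y, hy⟩ := hN ((biprod.snd : M ⊞ N ⟶ N).app U m)
  refine ⟨(biprod.inl : M ⟶ M ⊞ N).app U x + (biprod.inr : N ⟶ M ⊞ N).app U y, ?_⟩
  have e : (biprod.inl : M ⟶ M ⊞ N).app U ((biprod.fst : M ⊞ N ⟶ M).app U m) +
      (biprod.inr : N ⟶ M ⊞ N).app U ((biprod.snd : M ⊞ N ⟶ N).app U m) = m :=
    congr(Modules.Hom.app $(biprod.total (X := M) (Y := N)) U m)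
  rw [smul_add, ← Hom.app_smul, ← Hom.app_smul, hx, hy, Hom.app_smul, Hom.app_smul, ← smul_add, e]

/-- As `divisible U a s` is closed under direct sums and retracts, it is enough to check that it
contains the cohomology of the generators. The claim is made for all degrees at once because of the
closure under shifts. -/
lemma divisible_homology_of_addClosure {T S : ObjectProperty (DerivedCategory X.Modules)}
    (hS : ∀ E, S E → ∀ n, divisible U a s ((DerivedCategory.homologyFunctor X.Modules n).obj E))
    {E : DerivedCategory X.Modules} (hE : addClosure T S E) (n : ℤ) :
    divisible U a s ((DerivedCategory.homologyFunctor X.Modules n).obj E) := by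
  induction hE generalizing n with
  | of E _ h => exact hS E h n
  | zero E _ h => exact divisible_of_isZero (Functor.map_isZero _ h)
  | shift E m _ _ ih =>
    exact divisible_of_retract (.ofIso ((((DerivedCategory.homologyFunctor X.Modules 0).shiftIso
      m n (m + n) rfl).app E))) (ih (m + n))
  | coprod E F _ _ _ ihE ihF =>
    have := preservesBinaryBiproduct_of_preservesBiproduct
      (DerivedCategory.homologyFunctor X.Modules n) E F
    exact divisible_of_retract (.ofIso (Functor.mapBiprod _ E F)) (divisible_biprod (ihE n) (ihF n))
  | summand E F r _ _ ih => exact divisible_of_retract (r.map _) (ih n)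

end AlgebraicGeometry.Scheme

/-! ### Normality and the level of the structure sheaf -/

namespace AlgebraicGeometry.Scheme

open Modules

variable {X : Scheme.{u}} [IsIntegral X]

lemma isNormal_of_isIntegrallyClosed
    (h : ∀ U : X.Opens, IsAffineOpen U → Nonempty U → IsIntegrallyClosed Γ(X, U)) :
    X.IsNormal := by
  intro x
  obtain ⟨_, ⟨U, hU, rfl⟩, hx, -⟩ := X.isBasis_affineOpens.exists_subset_of_mem_open
    (Set.mem_univ x) isOpen_univ
  have : Nonempty U := ⟨x, hx⟩
  have := h U hU this
  let := X.presheaf.algebra_section_stalk ⟨x, hx⟩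
  have := hU.isLocalization_stalk ⟨x, hx⟩
  exact ⟨inferInstance, isIntegrallyClosed_of_isLocalization (X.presheaf.stalk x)
    (hU.primeIdealOf ⟨x, hx⟩).asIdeal.primeCompl (Ideal.primeCompl_le_nonZeroDivisors _)⟩

lemma IsNormal.isIntegrallyClosed (h : X.IsNormal) {U : X.Opens} (hU : IsAffineOpen U)
    [Nonempty U] : IsIntegrallyClosed Γ(X, U) := by
  refine IsIntegrallyClosed.of_localization_maximal fun p _ hp ↦ ?_
  let y : PrimeSpectrum Γ(X, U) := ⟨p, hp.isPrime⟩
  have hy : hU.fromSpec y ∈ U := hU.opensRange_fromSpec.le ⟨y, rfl⟩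
  let := X.presheaf.algebra_section_stalk ⟨_, hy⟩
  have : IsLocalization.AtPrime (X.presheaf.stalk (hU.fromSpec y)) p :=
    hU.isLocalization_stalk' y hy
  have := (h (hU.fromSpec y)).2
  exact .of_equiv (IsLocalization.algEquiv p.primeCompl (X.presheaf.stalk (hU.fromSpec y))
    (Localization.AtPrime p)).toRingEquiv

lemma IsNormal.bijective_normalizationMap_app (h : X.IsNormal) {U : X.Opens}
    (hU : IsAffineOpen U) : Function.Bijective (X.normalizationMap.app U) := by
  obtain hE | hU' := isEmpty_or_nonempty U
  · obtain rfl : U = ⊥ := by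
      ext x
      simpa using fun hx ↦ hE.elim ⟨x, hx⟩
    have h₁ : Subsingleton Γ(X, ⊥) := inferInstance
    have h₂ : Subsingleton Γ(X.normalizationScheme, X.normalizationMap ⁻¹ᵁ ⊥) :=
      inferInstanceAs (Subsingleton Γ(X.normalizationScheme, ⊥))
    exact ⟨fun _ _ _ ↦ h₁.elim _ _, fun y ↦ ⟨0, h₂.elim _ _⟩⟩
  have hic := h.isIntegrallyClosed hU
  have := functionField_isFractionRing_of_isAffineOpen X U hU
  obtain ⟨φ, hφ⟩ := X.exists_integralClosure_ringEquiv hU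
  have hb : Function.Bijective
      (algebraMap Γ(X, U) (integralClosure Γ(X, U) X.functionField)) := by
    refine ⟨FaithfulSMul.algebraMap_injective _ _, fun x ↦ ?_⟩
    obtain ⟨y, hy⟩ := (isIntegrallyClosed_iff X.functionField).1 hic x.2
    exact ⟨y, Subtype.ext hy⟩
  convert φ.bijective.comp hb
  ext a
  exact (hφ a).symm

lemma IsNormal.nonempty_structureSheaf_iso (h : X.IsNormal) :
    Nonempty (structureSheaf X ≅
      (pushforward X.normalizationMap).obj (structureSheaf X.normalizationScheme)) := by
  let θ : structureSheaf X ⟶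
      (pushforward X.normalizationMap).obj (structureSheaf X.normalizationScheme) :=
    SheafOfModules.unitToPushforwardObjUnit X.normalizationMap.toRingCatSheafHom
  let θ' : (⟨_, (structureSheaf X).isSheaf⟩ : TopCat.Sheaf Ab.{u} X) ⟶
    ⟨_, Modules.isSheaf ((pushforward X.normalizationMap).obj
      (structureSheaf X.normalizationScheme))⟩ := ⟨θ.mapPresheaf⟩
  have hθ' : IsIso θ' := by
    refine TopCat.Sheaf.isIso_iff_isIso_basis (B := fun U : X.affineOpens ↦ U.1)
      (by simpa using X.isBasis_affineOpens) fun U ↦ ?_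
    rw [ConcreteCategory.isIso_iff_bijective]
    exact h.bijective_normalizationMap_app U.2
  have : IsIso ((toPresheaf X).map θ) :=
    @Functor.map_isIso _ _ _ _ _ _ (TopCat.Sheaf.forget Ab.{u} X) θ' hθ'
  have := isIso_of_reflects_iso θ (toPresheaf X)
  exact ⟨asIso θ⟩

/-- If `x = a / s` is integral over `Γ(X, U)`, then `a • m = s • (x m)` in `ν_* 𝒪`. -/
lemma divisible_pushforward_normalizationMap {U : X.Opens} (hU : IsAffineOpen U) [Nonempty U]
    {a s : Γ(X, U)} {x : X.functionField} (hx : _root_.IsIntegral Γ(X, U) x)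
    (h : algebraMap _ _ s * x = algebraMap _ _ a) :
    divisible U a s ((pushforward X.normalizationMap).obj
      (structureSheaf X.normalizationScheme)) := by
  obtain ⟨φ, hφ⟩ := X.exists_integralClosure_ringEquiv hU
  intro (m : Γ(X.normalizationScheme, X.normalizationMap ⁻¹ᵁ U))
  let m' : Γ(X.normalizationScheme, X.normalizationMap ⁻¹ᵁ U) := φ ⟨x, hx⟩ * m
  refine ⟨m', ?_⟩
  change X.normalizationMap.app U s * (φ ⟨x, hx⟩ * m) = X.normalizationMap.app U a * m
  rw [← hφ, ← hφ, ← mul_assoc, ← map_mul]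
  congr 2
  exact Subtype.ext h

lemma exists_generatedIn_of_level_le_one {D : Type*} [Category* D] [Preadditive D]
    [HasZeroObject D] [HasBinaryBiproducts D] [HasShift D ℤ]
    [∀ n : ℤ, (shiftFunctor D n).Additive] [Pretriangulated D] {T S : ObjectProperty D} {E : D}
    (h : level T S E ≤ 1) : addClosure T (fun X ↦ IsZero X) E ∨ addClosure T S E := by
  by_contra! H
  have : (2 : ℕ∞) ≤ level T S E := by
    refine le_iInf₂ fun n hn ↦ ?_
    match n, hn with
    | 0, hn => exact (H.1 hn).elim
    | 1, hn => exact (H.2 hn).elim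
    | n + 2, _ => push_cast; exact le_add_self
  exact absurd (this.trans h) (by decide)

/-- An element `a / s` of the function field integral over `Γ(X, U)` belongs to `Γ(X, U)`, as `1`
is a section of `𝒪_X` over `U` such that `a • 1` is divisible by `s`. -/
lemma IsNormal.of_level_le_one (hlevel : level X.derivedBoundedCoherent
    (ObjectProperty.singleton (derivedPushforwardStructureSheaf X.normalizationMap))
    X.derivedStructureSheaf ≤ 1) : X.IsNormal := by
  refine isNormal_of_isIntegrallyClosed fun U hU _ ↦ ?_
  have := functionField_isFractionRing_of_isAffineOpen X U hU
  refine (isIntegrallyClosed_iff X.functionField).2 fun {x} hx ↦ ?_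
  obtain ⟨a, s, hs, rfl⟩ := IsFractionRing.div_surjective (A := Γ(X, U)) x
  have hs' : algebraMap Γ(X, U) X.functionField s ≠ 0 := by
    simpa using nonZeroDivisors.ne_zero hs
  have hpush := divisible_pushforward_normalizationMap hU hx (mul_div_cancel₀ _ hs')
  obtain ⟨e⟩ := nonempty_derivedPushforwardStructureSheaf_iso X.normalizationMap
  have hdiv (n : ℤ) : divisible U a s
      ((DerivedCategory.homologyFunctor X.Modules n).obj X.derivedStructureSheaf) := by
    obtain h | h := exists_generatedIn_of_level_le_one hlevel
    · exact divisible_homology_of_addClosure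
        (fun E hE n ↦ divisible_of_isZero (Functor.map_isZero _ hE)) h n
    · refine divisible_homology_of_addClosure ?_ h n
      rintro _ ⟨⟩ n
      refine divisible_of_retract
        (.ofIso ((DerivedCategory.homologyFunctor X.Modules n).mapIso e)) ?_
      obtain rfl | hn := eq_or_ne n 0
      · exact divisible_of_retract (.ofIso
          ((DerivedCategory.singleFunctorCompHomologyFunctorIso X.Modules 0).app _)) hpush
      · exact divisible_of_isZero (isZero_homologyFunctor_singleFunctor_obj _ hn)
  have hO : divisible U a s (structureSheaf X) := divisible_of_retract (.ofIso
    ((DerivedCategory.singleFunctorCompHomologyFunctorIso X.Modules 0).app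
      (structureSheaf X)).symm) (hdiv 0)
  obtain ⟨y, hy⟩ : ∃ y : Γ(X, U), s * y = a := by
    obtain ⟨y, hy⟩ := hO (1 : Γ(X, U))
    exact ⟨y, hy.trans (mul_one a)⟩
  refine ⟨y, ?_⟩
  rw [eq_div_iff hs', mul_comm, ← map_mul, hy]

lemma IsNormal.level_le_one (h : X.IsNormal) (hX : X.IsNagata) :
    level X.derivedBoundedCoherent
      (ObjectProperty.singleton (derivedPushforwardStructureSheaf X.normalizationMap))
      X.derivedStructureSheaf ≤ 1 := by
  obtain ⟨e⟩ := nonempty_derivedPushforwardStructureSheaf_iso X.normalizationMap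
  obtain ⟨θ⟩ := h.nonempty_structureSheaf_iso
  refine iInf₂_le_of_le 1 ?_ le_rfl
  -- The class `generatedIn _ _ 1` is closed under isomorphisms, as these are retracts.
  refine addClosure.summand (derivedPushforwardStructureSheaf X.normalizationMap) _
    (.ofIso ((DerivedCategory.singleFunctor X.Modules 0).mapIso θ ≪≫ e.symm))
    (derivedBoundedCoherent_derivedStructureSheaf hX) (.of _ ?_ ?_)
  · exact derivedBoundedCoherent_derivedPushforwardStructureSheaf hX
  · exact (ObjectProperty.singleton_iff _ _).2 rfl

end AlgebraicGeometry.Scheme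

theorem theoremB (X : Scheme.{u}) [IsIntegral X] (hX : X.IsNagata) :
    X.derivedBoundedCoherent X.derivedStructureSheaf ∧
    X.derivedBoundedCoherent (Scheme.derivedPushforwardStructureSheaf X.normalizationMap) ∧
    (X.IsNormal ↔
      level X.derivedBoundedCoherent
        (ObjectProperty.singleton (Scheme.derivedPushforwardStructureSheaf X.normalizationMap))
        X.derivedStructureSheaf ≤ 1) :=
  ⟨Scheme.derivedBoundedCoherent_derivedStructureSheaf hX,
    Scheme.derivedBoundedCoherent_derivedPushforwardStructureSheaf hX,
    fun h ↦ h.level_le_one hX, .of_level_le_one⟩
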